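/- Let $K$ be an algebraically closed field, $\Lambda$ a finite-dimensional $K$-algebra, and $\Lambda\text{-mod}$ the category of finitely generated left $\Lambda$-modules. Let $E$ be a generator in $\Lambda\text{-mod}$, i.e. $E$ is finitely generated and every finitely generated left $\Lambda$-module is a quotient of $E^n$ for some $n$; let $\operatorname{add}E$ be the class of direct summands of finite direct sums of copies of $E$, and let $\Gamma=(\operatorname{End}_\Lambda E)^{op}$, so that $\operatorname{Hom}_\Lambda(E,M)$ is a left $\Gamma$-module for every left $\Lambda$-module $M$. We use the following notions. (1) A module $M\in\Lambda\text{-mod}$ is $E$-Gorenstein projective if $M\simeq\operatorname{Im}d_0$ for some exact sequence $\cdots\to E_{-1}\xrightarrow{d_{-1}}E_0\xrightarrow{d_0}E_1\to\cdots$ with all $E_i\in\operatorname{add}E$ that stays exact under $\operatorname{Hom}_\Lambda(-,E)$ and under $\operatorname{Hom}_\Lambda(E,-)$. (2) A module $M\in\Lambda\text{-mod}$ is $E$-rigid if, for a minimal $\operatorname{add}E$-presentation of $M$, that is, an exact sequence $E_1\xrightarrow{f_1}E_0\xrightarrow{f_0}M\to0$ in which each $f_i$ is a minimal right $\operatorname{add}E$-approximation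 of $\operatorname{Im}f_i$, the map $\operatorname{Hom}_\Lambda(f_1,M)\colon\operatorname{Hom}_\Lambda(E_0,M)\to\operatorname{Hom}_\Lambda(E_1,M)$ is surjective. (3) A finitely generated left $\Gamma$-module $N$ is Gorenstein projective if $N\simeq\operatorname{Im}(P_{-1}\to P_0)$ for some exact sequence $\cdots\to P_{-1}\to P_0\to P_1\to\cdots$ of finitely generated projective left $\Gamma$-modules that stays exact under $\operatorname{Hom}_\Gamma(-,\Gamma)$. (4) A finitely generated left $\Gamma$-module $N$ is $\tau$-rigid if $\operatorname{Hom}_\Gamma(N,\tau N)=0$, where $\tau N=\operatorname{Hom}_K(\operatorname{Tr}N,K)$ is the Auslander-Reiten translate: for a minimal projective presentation $P_1\xrightarrow{f}P_0\to N\to0$, the right $\Gamma$-module $\operatorname{Tr}N$ is the cokernel of $\operatorname{Hom}_\Gamma(f,\Gamma)\colon\operatorname{Hom}_\Gamma(P_0,\Gamma)\to\operatorname{Hom}_\Gamma(P_1,\Gamma)$. Let $\mathcal{EG}(E)$ be the set of isomorphism classes of indecomposable modules in $\Lambda\text{-mod}$ that are both $E$-Gorenstein projective and $E$-rigid, and let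 $\mathcal{TG}(\Gamma)$ be the set of isomorphism classes of indecomposable finitely generated left $\Gamma$-modules that are both Gorenstein projective and $\tau$-rigid. Then $M\mapsto\operatorname{Hom}_\Lambda(E,M)$ induces a bijection $\mathcal{EG}(E)\to\mathcal{TG}(\Gamma)$. -/

import Mathlib

open CategoryTheory MulOpposite

universe u v w

noncomputable section

namespace ERigid

section ModuleNotions

variable {R : Type u} [Ring R]

/-- A module is indecomposable if it is nonzero and is not the internal direct sum of two nonzero
submodules. -/
def IsIndecomposable (R : Type u) [Ring R] (M : Type v) [AddCommGroup M] [Module R M] : Prop :=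
  Nontrivial M ∧ ∀ p q : Submodule R M, IsCompl p q → p = ⊥ ∨ q = ⊥

/-- `X ∈ add E`: `X` is isomorphic to a direct summand of `E ^ n` for some `n`. -/
def InAdd (R : Type u) [Ring R] (E : Type v) [AddCommGroup E] [Module R E]
    (X : Type w) [AddCommGroup X] [Module R X] : Prop :=
  ∃ (n : ℕ) (i : X →ₗ[R] (Fin n → E)) (p : (Fin n → E) →ₗ[R] X), p ∘ₗ i = LinearMap.id

/-- `E` is a generator of the category of finitely generated `R`-modules: it is finitely generated
and every finitely generated module is a quotient of some `E ^ n`. -/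
def IsGenerator (R : Type u) [Ring R] (E : Type u) [AddCommGroup E] [Module R E] : Prop :=
  Module.Finite R E ∧
    ∀ M : ModuleCat.{u} R, Module.Finite R M →
      ∃ (n : ℕ) (p : (Fin n → E) →ₗ[R] M), Function.Surjective p

/-- Right minimality: every endomorphism `g` of the source with `f ∘ g = f` is an automorphism. -/
def IsRightMinimal {X : Type v} {Y : Type w} [AddCommGroup X] [Module R X]
    [AddCommGroup Y] [Module R Y] (f : X →ₗ[R] Y) : Prop :=
  ∀ g : X →ₗ[R] X, f ∘ₗ g = f → Function.Bijective g

/-- `f : X → Y` is a right `add E`-approximation of `Y`. -/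
def IsRightAddApprox (E : Type v) [AddCommGroup E] [Module R E]
    {X : Type v} {Y : Type w} [AddCommGroup X] [Module R X]
    [AddCommGroup Y] [Module R Y] (f : X →ₗ[R] Y) : Prop :=
  InAdd R E X ∧
    ∀ X' : ModuleCat.{v} R, InAdd R E X' →
      ∀ h : X' →ₗ[R] Y, ∃ k : X' →ₗ[R] X, f ∘ₗ k = h

/-- `E₁ --f₁--> E₀ --f₀--> M --> 0` is a minimal `add E`-presentation of `M`: it is exact and
`f₀`, `f₁` are minimal right `add E`-approximations of their images (the image of `f₀` is `M`). -/
structure IsMinAddPresentation (E : Type v) [AddCommGroup E] [Module R E]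
    {E₁ E₀ M : Type v} [AddCommGroup E₁] [Module R E₁] [AddCommGroup E₀] [Module R E₀]
    [AddCommGroup M] [Module R M] (f₁ : E₁ →ₗ[R] E₀) (f₀ : E₀ →ₗ[R] M) : Prop where
  exact : Function.Exact f₁ f₀
  surjective : Function.Surjective f₀
  approx₀ : IsRightAddApprox E f₀
  minimal₀ : IsRightMinimal f₀
  approx₁ : IsRightAddApprox E f₁.rangeRestrict
  minimal₁ : IsRightMinimal f₁.rangeRestrict

/-- `M` is `E`-rigid: `Hom(f₁, M) : Hom(E₀, M) → Hom(E₁, M)` is surjective for a minimal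
`add E`-presentation `E₁ --f₁--> E₀ --> M --> 0` (which is unique up to isomorphism). -/
def IsERigid (R : Type u) [Ring R] (E : Type v) [AddCommGroup E] [Module R E]
    (M : Type v) [AddCommGroup M] [Module R M] : Prop :=
  ∃ (E₁ E₀ : ModuleCat.{v} R) (f₁ : E₁ →ₗ[R] E₀) (f₀ : E₀ →ₗ[R] M),
    IsMinAddPresentation E f₁ f₀ ∧
      Function.Surjective (fun g : E₀ →ₗ[R] M => g ∘ₗ f₁)

/-- `M` is `E`-Gorenstein projective: `M` is isomorphic to the image of `d 0` in an exact sequence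
`⋯ → X (-1) → X 0 → X 1 → ⋯` in `add E` that stays exact under `Hom(-, E)` and `Hom(E, -)`. -/
def IsEGorensteinProjective (R : Type u) [Ring R] (E : Type v) [AddCommGroup E] [Module R E]
    (M : Type v) [AddCommGroup M] [Module R M] : Prop :=
  ∃ (X : ℤ → ModuleCat.{v} R) (d : ∀ i, X i →ₗ[R] X (i + 1)),
    (∀ i, InAdd R E (X i)) ∧
    (∀ i, Function.Exact (d i) (d (i + 1))) ∧
    (∀ i, Function.Exact
      (fun g : X (i + 1 + 1) →ₗ[R] E => g ∘ₗ d (i + 1))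
      (fun g : X (i + 1) →ₗ[R] E => g ∘ₗ d i)) ∧
    (∀ i, Function.Exact
      (fun g : E →ₗ[R] X i => d i ∘ₗ g)
      (fun g : E →ₗ[R] X (i + 1) => d (i + 1) ∘ₗ g)) ∧
    Nonempty (M ≃ₗ[R] LinearMap.range (d 0))

/-- `M` is Gorenstein projective: `M` is isomorphic to the image of `P (-1) → P 0` in an exact
sequence `⋯ → P (-1) → P 0 → P 1 → ⋯` of finitely generated projective modules that stays exact
under `Hom(-, R)`. -/
def IsGorensteinProjective (R : Type u) [Ring R]
    (M : Type v) [AddCommGroup M] [Module R M] : Prop :=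
  ∃ (P : ℤ → ModuleCat.{v} R) (d : ∀ i, P i →ₗ[R] P (i + 1)),
    (∀ i, Module.Finite R (P i) ∧ Module.Projective R (P i)) ∧
    (∀ i, Function.Exact (d i) (d (i + 1))) ∧
    (∀ i, Function.Exact
      (fun g : P (i + 1 + 1) →ₗ[R] R => g ∘ₗ d (i + 1))
      (fun g : P (i + 1) →ₗ[R] R => g ∘ₗ d i)) ∧
    Nonempty (M ≃ₗ[R] LinearMap.range (d (-1)))

/-- A projective cover: a surjection from a finitely generated projective module whose kernel is
superfluous. -/
structure IsProjectiveCover {P : Type v} {M : Type w} [AddCommGroup P] [Module R P]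
    [AddCommGroup M] [Module R M] (f : P →ₗ[R] M) : Prop where
  finite : Module.Finite R P
  projective : Module.Projective R P
  surjective : Function.Surjective f
  superfluous : ∀ N : Submodule R P, N ⊔ LinearMap.ker f = ⊤ → N = ⊤

/-- `P₁ --f₁--> P₀ --f₀--> M --> 0` is a minimal projective presentation of `M`. -/
structure IsMinProjPresentation {P₁ P₀ M : Type v} [AddCommGroup P₁] [Module R P₁]
    [AddCommGroup P₀] [Module R P₀] [AddCommGroup M] [Module R M]
    (f₁ : P₁ →ₗ[R] P₀) (f₀ : P₀ →ₗ[R] M) : Prop where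
  exact : Function.Exact f₁ f₀
  cover₀ : IsProjectiveCover f₀
  cover₁ : IsProjectiveCover f₁.rangeRestrict

end ModuleNotions

section AuslanderReitenTranslate

/-- The `K`-dual `Hom_K(T, K)` of a right `R`-module `T`; it is a left `R`-module below. -/
def KDual (K : Type w) [Field K] (T : Type v) [AddCommGroup T] [Module K T] : Type (max v w) :=
  T →ₗ[K] K

instance kDualAddCommGroup (K : Type w) [Field K] (T : Type v) [AddCommGroup T] [Module K T] :
    AddCommGroup (KDual K T) :=
  inferInstanceAs (AddCommGroup (T →ₗ[K] K))

/-- The left `R`-module structure on the `K`-dual of a right `R`-module: `(r • φ) t = φ (t r)`. -/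
instance kDualModule (K : Type w) [Field K] (R : Type u) [Ring R] (T : Type v) [AddCommGroup T] [Module K T]
    [Module Rᵐᵒᵖ T] [SMulCommClass Rᵐᵒᵖ K T] : Module R (KDual K T) where
  smul r φ := LinearMap.comp (φ : T →ₗ[K] K) (DistribSMul.toLinearMap K T (op r))
  one_smul φ := by
    refine LinearMap.ext fun t => ?_
    let ψ : T →ₗ[K] K := φ
    show ψ (op (1 : R) • t) = ψ t
    rw [MulOpposite.op_one, one_smul]
  mul_smul r s φ := by
    refine LinearMap.ext fun t => ?_
    let ψ : T →ₗ[K] K := φ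
    show ψ (op (r * s) • t) = ψ (op s • op r • t)
    rw [MulOpposite.op_mul, mul_smul]
  smul_zero _ := rfl
  smul_add _ _ _ := rfl
  add_smul r s φ := by
    refine LinearMap.ext fun t => ?_
    let ψ : T →ₗ[K] K := φ
    show ψ (op (r + s) • t) = ψ (op r • t) + ψ (op s • t)
    rw [MulOpposite.op_add, add_smul, map_add]
  zero_smul φ := by
    refine LinearMap.ext fun t => ?_
    let ψ : T →ₗ[K] K := φ
    show ψ (op (0 : R) • t) = 0
    rw [MulOpposite.op_zero, zero_smul, map_zero]

variable {R : Type u} [Ring R] {P₁ P₀ : Type v} [AddCommGroup P₁] [Module R P₁]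
  [AddCommGroup P₀] [Module R P₀]

/-- The map of right modules `f* = Hom_R(f, R) : Hom_R(P₀, R) → Hom_R(P₁, R)`. -/
def starMap (f : P₁ →ₗ[R] P₀) : (P₀ →ₗ[R] R) →ₗ[Rᵐᵒᵖ] (P₁ →ₗ[R] R) where
  toFun g := g ∘ₗ f
  map_add' _ _ := rfl
  map_smul' _ _ := rfl

/-- The cokernel of `f*`, a right `R`-module. If `f` is the first map of a minimal projective
presentation of `M`, this is the Auslander-Bridger transpose `Tr M`. -/
abbrev Transpose (f : P₁ →ₗ[R] P₀) : Type (max u v) :=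
  (P₁ →ₗ[R] R) ⧸ LinearMap.range (starMap f)

/-- The left `R`-module `D Coker f*`. If `f` is the first map of a minimal projective presentation
of `M`, this is the Auslander-Reiten translate `τ M = D Tr M`. -/
abbrev Tau (K : Type w) [Field K] [Algebra K R] (f : P₁ →ₗ[R] P₀) : Type (max u v w) :=
  KDual K (Transpose f)

/-- `M` is `τ`-rigid: `Hom_R(M, τ M) = 0`, where `τ M` is computed from a minimal projective
presentation of `M` (which is unique up to isomorphism). -/
def IsTauRigid (K : Type w) [Field K] (R : Type u) [Ring R] [Algebra K R]
    (M : Type v) [AddCommGroup M] [Module R M] : Prop :=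
  ∃ (P₁ P₀ : ModuleCat.{v} R) (f₁ : P₁ →ₗ[R] P₀) (f₀ : P₀ →ₗ[R] M),
    IsMinProjPresentation f₁ f₀ ∧ ∀ h : M →ₗ[R] Tau K f₁, h = 0

end AuslanderReitenTranslate

section HomFunctor

variable (R : Type u) [Ring R] (E : Type u) [AddCommGroup E] [Module R E]

/-- The left module structure of `Hom_R(E, M)` over `(End_R E)ᵒᵖ`: `op a • f = f ∘ a`. -/
instance homModule (M : Type v) [AddCommGroup M] [Module R M] :
    Module (Module.End R E)ᵐᵒᵖ (E →ₗ[R] M) where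
  smul a f := f ∘ₗ a.unop
  one_smul _ := rfl
  mul_smul _ _ _ := rfl
  smul_zero _ := rfl
  smul_add _ _ _ := rfl
  add_smul _ _ f := LinearMap.comp_add _ _ f
  zero_smul f := LinearMap.comp_zero f

/-- The functor `Hom_R(E, -)` from `R`-modules to `(End_R E)ᵒᵖ`-modules. -/
def homFunctor : ModuleCat.{u} R ⥤ ModuleCat.{u} (Module.End R E)ᵐᵒᵖ where
  obj M := ModuleCat.of (Module.End R E)ᵐᵒᵖ (E →ₗ[R] M)
  map {M N} φ := ModuleCat.ofHom
    { toFun := fun f => φ.hom ∘ₗ f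
      map_add' := fun f g => LinearMap.comp_add f g φ.hom
      map_smul' := fun _ _ => rfl }

/-- Isomorphism classes of `R`-modules. -/
abbrev IsoClass (R : Type u) [Ring R] : Type (u + 1) :=
  Quotient (isIsomorphicSetoid (ModuleCat.{u} R))

/-- The map on isomorphism classes of modules induced by `Hom_R(E, -)`. -/
def homIsoClass : IsoClass R → IsoClass (Module.End R E)ᵐᵒᵖ :=
  Quotient.map (homFunctor R E).obj fun _ _ ⟨e⟩ => ⟨(homFunctor R E).mapIso e⟩

/-- Isomorphism classes of finitely generated indecomposable `E`-Gorenstein projective `E`-rigid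
`R`-modules. -/
def EG : Set (IsoClass R) :=
  {c | ∃ M : ModuleCat.{u} R, (Quotient.mk _ M : IsoClass R) = c ∧ Module.Finite R M ∧
    IsIndecomposable R M ∧ IsEGorensteinProjective R E M ∧ IsERigid R E M}

/-- Isomorphism classes of finitely generated indecomposable Gorenstein projective `τ`-rigid modules
over a `K`-algebra `R`. -/
def TG (K : Type u) [Field K] (R : Type u) [Ring R] [Algebra K R] : Set (IsoClass R) :=
  {c | ∃ N : ModuleCat.{u} R, (Quotient.mk _ N : IsoClass R) = c ∧ Module.Finite R N ∧
    IsIndecomposable R N ∧ IsGorensteinProjective R N ∧ IsTauRigid K R N}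

end HomFunctor

end ERigid

end

/-! Write `F = Hom(E, -)` and `Γ = (End E)ᵒᵖ`. A generator has full trace: `1 = ∑ p_j(e_j)` with
`p_j : E → Λ` and `e_j ∈ E`. This identity alone makes `F` fully faithful on all modules
(`HasFullTrace.homMap_injective`, `HasFullTrace.homMap_surjective`) and makes it reflect
surjectivity and exactness. Moreover `F(E) = Γ`, and `F` identifies `add E` with the finitely
generated projective `Γ`-modules (`HasFullTrace.exists_inAdd_equiv`).

Hence `F`-exact complexes in `add E` correspond to exact complexes of projectives, `Hom(-, E)`
corresponds to `Hom(-, Γ)` (`HasFullTrace.exact_dual_iff`), and images match images. This handles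
the Gorenstein conditions.

For rigidity, `F` matches minimal `add E`-presentations with minimal projective presentations,
because right minimality of a surjection from a finitely generated projective means that its kernel
is superfluous. For `f : P₁ → P₀` between finitely generated projectives, a map `N → D Coker f*`
amounts to a functional on `Hom(P₁, N)` that kills all composites `g ∘ f`; so `Hom(N, D Coker f*) =
0` exactly when `Hom(f, N)` is surjective. By full faithfulness this surjectivity is the one
defining `E`-rigidity. -/

noncomputable section

namespace ERigid

/-! ### Indecomposability through idempotents -/

section Indecomposable

/-- A nonzero module is indecomposable iff its endomorphism ring has no nontrivial idempotents. -/
theorem isIndecomposable_iff_idempotent {R : Type u} [Ring R] {M : Type v} [AddCommGroup M]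
    [Module R M] : IsIndecomposable R M ↔
      Nontrivial M ∧ ∀ e : M →ₗ[R] M, e ∘ₗ e = e → e = 0 ∨ e = LinearMap.id := by
  refine and_congr_right fun _ => ⟨fun h e he => ?_, fun h p q hpq => ?_⟩
  · have hc : IsCompl (LinearMap.range e) (LinearMap.ker e) :=
      LinearMap.IsIdempotentElem.isCompl (f := e) he
    rcases h _ _ hc with h | h
    · exact Or.inl (LinearMap.range_eq_bot.1 h)
    · refine Or.inr (LinearMap.ext fun x => LinearMap.ker_eq_bot.1 h ?_)
      exact LinearMap.congr_fun he x
  · rcases h (p.projection q hpq) (Submodule.isIdempotentElem_projection hpq) with h | h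
    · left
      rw [← Submodule.range_projection hpq, h, LinearMap.range_zero]
    · right
      rw [← Submodule.ker_projection hpq, h, LinearMap.ker_id]

end Indecomposable

/-! ### Projective covers, right minimality and dual bases -/

section Projective

variable {R : Type u} [Ring R] {P : Type v} {N : Type w} [AddCommGroup P] [Module R P]
  [AddCommGroup N] [Module R N]

/-- A right minimal surjection from a finitely generated projective module is a projective
cover. -/
theorem isProjectiveCover_of_isRightMinimal {f : P →ₗ[R] N} (hfin : Module.Finite R P)
    (hproj : Module.Projective R P) (hf : Function.Surjective f) (hmin : IsRightMinimal f) :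
    IsProjectiveCover f where
  finite := hfin
  projective := hproj
  surjective := hf
  superfluous L hL := by
    have hs : Function.Surjective (f ∘ₗ L.subtype) := by
      intro y
      obtain ⟨x, rfl⟩ := hf y
      obtain ⟨a, ha, b, hb, rfl⟩ := Submodule.mem_sup.1 (hL ▸ Submodule.mem_top : x ∈ _)
      refine ⟨⟨a, ha⟩, ?_⟩
      simp [LinearMap.mem_ker.1 hb]
    -- Lifting `f` through its restriction to `L` gives an endomorphism of `P` over `f` with image
    -- in `L`; right minimality makes it onto, so `L = P`.
    obtain ⟨g, hg⟩ := Module.projective_lifting_property (f ∘ₗ L.subtype) f hs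
    have hb := hmin (L.subtype ∘ₗ g) (by rw [← LinearMap.comp_assoc, hg])
    rw [eq_top_iff]
    intro x _
    obtain ⟨y, rfl⟩ := hb.2 x
    exact (g y).2

/-- If `f ∘ g = f`, then `x - g x ∈ ker f`, so superfluity makes `g` onto. A section `s` of `g`
again satisfies `f ∘ s = f`, so it is onto too, and `g` is injective. -/
theorem IsProjectiveCover.isRightMinimal {f : P →ₗ[R] N} (hf : IsProjectiveCover f) :
    IsRightMinimal f := by
  have := hf.projective
  have key : ∀ g : P →ₗ[R] P, f ∘ₗ g = f → Function.Surjective g := by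
    intro g hg
    rw [← LinearMap.range_eq_top]
    refine hf.superfluous _ (eq_top_iff.2 fun x _ => ?_)
    refine Submodule.mem_sup.2 ⟨g x, ⟨x, rfl⟩, x - g x, ?_, by abel⟩
    have := LinearMap.congr_fun hg x
    rw [LinearMap.comp_apply] at this
    rw [LinearMap.mem_ker, map_sub, this, sub_self]
  intro g hg
  obtain ⟨s, hs⟩ := Module.projective_lifting_property g LinearMap.id (key g hg)
  have hfs : f ∘ₗ s = f := by
    conv_lhs => rw [← hg]
    rw [LinearMap.comp_assoc, hs, LinearMap.comp_id]
  refine ⟨fun a b hab => ?_, key g hg⟩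
  obtain ⟨a, rfl⟩ := key s hfs a
  obtain ⟨b, rfl⟩ := key s hfs b
  have h : ∀ x, g (s x) = x := LinearMap.congr_fun hs
  rw [h, h] at hab
  rw [hab]

/-- A finitely generated projective module has a finite dual basis. -/
theorem exists_dualBasis (R : Type u) [Ring R] (P : Type v) [AddCommGroup P] [Module R P]
    (hfin : Module.Finite R P) (hproj : Module.Projective R P) :
    ∃ (n : ℕ) (x : Fin n → P) (ξ : Fin n → P →ₗ[R] R), ∀ y, ∑ j, ξ j y • x j = y := by
  obtain ⟨n, p, hp⟩ := Module.Finite.exists_fin' R P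
  obtain ⟨s, hs⟩ := Module.projective_lifting_property p LinearMap.id hp
  refine ⟨n, fun j => p (Pi.single j 1), fun j => LinearMap.proj j ∘ₗ s, fun y => ?_⟩
  have : ∀ j, (LinearMap.proj j ∘ₗ s) y • p (Pi.single j 1) = p (Pi.single j (s y j)) := by
    intro j
    rw [← map_smul, ← Pi.single_smul, smul_eq_mul, mul_one]
    rfl
  simp_rw [this]
  rw [← map_sum, Finset.univ_sum_single]
  exact LinearMap.congr_fun hs y

end Projective

/-! ### Reindexing complete resolutions -/

section GorensteinShift

/-- Moves the distinguished image from `d (-1)` to `d 0`, the position used for `E`-Gorenstein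
projectives. -/
theorem IsGorensteinProjective.exists_range_zero {R : Type u} [Ring R] {M : Type v}
    [AddCommGroup M] [Module R M] (h : IsGorensteinProjective R M) :
    ∃ (P : ℤ → ModuleCat.{v} R) (d : ∀ i, P i →ₗ[R] P (i + 1)),
      (∀ i, Module.Finite R (P i) ∧ Module.Projective R (P i)) ∧
      (∀ i, Function.Exact (d i) (d (i + 1))) ∧
      (∀ i, Function.Exact
        (fun g : P (i + 1 + 1) →ₗ[R] R => g ∘ₗ d (i + 1))
        (fun g : P (i + 1) →ₗ[R] R => g ∘ₗ d i)) ∧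
      Nonempty (M ≃ₗ[R] LinearMap.range (d 0)) := by
  obtain ⟨P, d, hP, hd, hd', ⟨e⟩⟩ := h
  -- Keeping `i + 1 = j` as an argument lets each property be proved by `rfl` elimination, although
  -- `i - 1 + 1` and `i + 1 - 1` are not definitionally equal.
  let D : ∀ i j, i + 1 = j → (P i →ₗ[R] P j) := fun i j h => h ▸ d i
  have hD : ∀ i j k (h : i + 1 = j) (h' : j + 1 = k), Function.Exact (D i j h) (D j k h') := by
    rintro i _ _ rfl rfl
    exact hd i
  have hD' : ∀ i j k (h : i + 1 = j) (h' : j + 1 = k), Function.Exact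
      (fun g : P k →ₗ[R] R => g ∘ₗ D j k h') (fun g : P j →ₗ[R] R => g ∘ₗ D i j h) := by
    rintro i _ _ rfl rfl
    exact hd' i
  have he : ∀ i j (hi : i = -1) (h : i + 1 = j), Nonempty (M ≃ₗ[R] LinearMap.range (D i j h)) := by
    rintro _ _ rfl rfl
    exact ⟨e⟩
  exact ⟨fun i => P (i - 1), fun i => D (i - 1) (i + 1 - 1) (by ring), fun i => hP _,
    fun i => hD _ _ _ _ _, fun i => hD' _ _ _ _ _, he _ _ rfl (by ring)⟩

end GorensteinShift

/-! ### Vanishing of `Hom(N, D Coker f*)` versus surjectivity of `Hom(f, N)` -/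

section TauRigid

variable {R : Type u} [Ring R] {P₁ P₀ N : Type v} [AddCommGroup P₁] [Module R P₁]
  [AddCommGroup P₀] [Module R P₀] [AddCommGroup N] [Module R N]

/-- The rank-one maps `y ↦ ζ(y) a` span `Hom(P₁, N)`, so additive functionals are determined by
their values on them. -/
theorem eq_sum_smulRight_of_dualBasis {n : ℕ} {x : Fin n → P₁} {ξ : Fin n → P₁ →ₗ[R] R}
    (hx : ∀ y, ∑ j, ξ j y • x j = y) (k : P₁ →ₗ[R] N) :
    k = ∑ j, (ξ j).smulRight (k (x j)) := by
  ext y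
  conv_lhs => rw [← hx y]
  simp

/-- `Hom(N, D Coker f*)` vanishes if `Hom(f, N)` is surjective. -/
theorem eq_zero_of_surjective_comp (K : Type w) [Field K] [Algebra K R] {f : P₁ →ₗ[R] P₀}
    (h₁ : Module.Finite R P₁) (h₁' : Module.Projective R P₁)
    (h₀ : Module.Finite R P₀) (h₀' : Module.Projective R P₀)
    (hf : Function.Surjective (fun g : P₀ →ₗ[R] N => g ∘ₗ f)) (h : N →ₗ[R] Tau K f) : h = 0 := by
  obtain ⟨n, x, ξ, hx⟩ := exists_dualBasis R P₁ h₁ h₁'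
  obtain ⟨m, y, η, hy⟩ := exists_dualBasis R P₀ h₀ h₀'
  let B : N → (Transpose f →ₗ[K] K) := fun a => h a
  let H : N → (P₁ →ₗ[R] R) → K := fun a ζ => B a (Submodule.Quotient.mk ζ)
  have H_add : ∀ a b ζ, H (a + b) ζ = H a ζ + H b ζ := by
    intro a b ζ
    have : B (a + b) = B a + B b := map_add h a b
    simp only [H, this, LinearMap.add_apply]
  have H_sum : ∀ a (ζ : Fin n → P₁ →ₗ[R] R), H a (∑ j, ζ j) = ∑ j, H a (ζ j) := by
    intro a ζ
    simp only [H]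
    rw [← map_sum]
    exact congrArg _ (map_sum (Submodule.mkQ (LinearMap.range (starMap f))) ζ Finset.univ)
  have H_smul : ∀ (r : R) a ζ, H (r • a) ζ = H a (op r • ζ) := by
    intro r a ζ
    have : B (r • a) = (B a).comp (DistribSMul.toLinearMap K _ (op r)) := map_smul h r a
    simp only [H, this]
    rfl
  have H_comp : ∀ a (g : P₀ →ₗ[R] R), H a (g ∘ₗ f) = 0 := by
    intro a g
    have : (Submodule.Quotient.mk (g ∘ₗ f) : Transpose f) = 0 :=
      (Submodule.Quotient.mk_eq_zero _).2 ⟨g, rfl⟩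
    simp only [H]
    rw [this, map_zero]
  -- The functional on `Hom(P₁, N)` attached to `h`, with value `h(a)(ζ)` on the rank-one map
  -- `ζ.smulRight a`.
  let Θ : (P₁ →ₗ[R] N) →+ K :=
    AddMonoidHom.mk' (fun k => ∑ j, H (k (x j)) (ξ j)) (fun k l => by
      simp only [LinearMap.add_apply, H_add, Finset.sum_add_distrib])
  have Θ_smulRight : ∀ (ζ : P₁ →ₗ[R] R) a, Θ (ζ.smulRight a) = H a ζ := by
    intro ζ a
    have hζ : ζ = ∑ j, op (ζ (x j)) • ξ j := by
      refine LinearMap.ext fun z => ?_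
      conv_lhs => rw [← hx z]
      simp
    conv_rhs => rw [hζ, H_sum]
    simp only [Θ, AddMonoidHom.mk'_apply, LinearMap.smulRight_apply, H_smul]
  refine LinearMap.ext fun a => LinearMap.ext fun t => ?_
  obtain ⟨ζ, rfl⟩ := Submodule.Quotient.mk_surjective _ t
  change H a ζ = 0
  -- The rank-one map factors as `g ∘ f`. Expanding `g` in the dual basis of `P₀` gives rank-one
  -- terms with functionals `η i ∘ f`, which vanish in the transpose.
  obtain ⟨g, hg⟩ := hf (ζ.smulRight a)
  have hg' : ζ.smulRight a = ∑ i, ((η i) ∘ₗ f).smulRight (g (y i)) := by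
    rw [← hg]
    conv_lhs => rw [eq_sum_smulRight_of_dualBasis hy g]
    ext z
    simp
  rw [← Θ_smulRight, hg', map_sum]
  exact Finset.sum_eq_zero fun i _ => by rw [Θ_smulRight, H_comp]

/-- `Hom(f, N)` is surjective if `Hom(N, D Coker f*)` vanishes. -/
theorem surjective_comp_of_forall_eq_zero (K : Type w) [Field K] [Algebra K R] {f : P₁ →ₗ[R] P₀}
    (h₁ : Module.Finite R P₁) (h₁' : Module.Projective R P₁)
    (hf : ∀ h : N →ₗ[R] Tau K f, h = 0) :
    Function.Surjective (fun g : P₀ →ₗ[R] N => g ∘ₗ f) := by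
  obtain ⟨n, x, ξ, hx⟩ := exists_dualBasis R P₁ h₁ h₁'
  let _ : Module K N := Module.compHom N (algebraMap K R)
  have : IsScalarTower K R N := ⟨fun k r a => by
    rw [Algebra.smul_def, mul_smul]; rfl⟩
  have : SMulCommClass R K N := IsScalarTower.to_smulCommClass'
  let φ : (P₀ →ₗ[R] N) →ₗ[K] (P₁ →ₗ[R] N) :=
    { toFun := fun g => g ∘ₗ f
      map_add' := fun _ _ => rfl
      map_smul' := fun _ _ => rfl }
  suffices hφ : LinearMap.range φ = ⊤ from LinearMap.range_eq_top.1 hφ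
  by_contra hne
  -- A proper `K`-subspace lies in the kernel of a nonzero functional.
  obtain ⟨θ, hθ, hle⟩ := Submodule.exists_le_ker_of_lt_top _ (lt_top_iff_ne_top.2 hne)
  have hθf : ∀ g : P₀ →ₗ[R] N, θ (g ∘ₗ f) = 0 := fun g => hle ⟨g, rfl⟩
  -- `ζ ↦ θ (ζ.smulRight a)` descends to `Coker f*` because `θ` kills every map factoring through
  -- `f`; varying `a` gives the map `h` below.
  let A : N → (Transpose f →ₗ[K] K) := fun a =>
    { toFun := Quotient.lift (s := Submodule.quotientRel _)
        (fun ζ : P₁ →ₗ[R] R => θ (ζ.smulRight a)) (by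
          intro ζ ζ' hζ
          obtain ⟨g, hg⟩ := (Submodule.quotientRel_def _).1 hζ
          have := hθf (g.smulRight a)
          have h2 : (g.smulRight a) ∘ₗ f = ζ.smulRight a - ζ'.smulRight a := by
            ext z
            have := LinearMap.congr_fun hg z
            simp only [starMap, LinearMap.coe_mk, AddHom.coe_mk, LinearMap.comp_apply,
              LinearMap.sub_apply] at this
            simp [this, sub_smul]
          rw [h2, map_sub, sub_eq_zero] at this
          exact this)
      map_add' := by
        intro s t
        obtain ⟨ζ, rfl⟩ := Submodule.Quotient.mk_surjective _ s
        obtain ⟨ζ', rfl⟩ := Submodule.Quotient.mk_surjective _ t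
        change θ ((ζ + ζ').smulRight a) = θ (ζ.smulRight a) + θ (ζ'.smulRight a)
        rw [← map_add]
        congr 1
        ext z
        simp [add_smul]
      map_smul' := by
        intro k s
        obtain ⟨ζ, rfl⟩ := Submodule.Quotient.mk_surjective _ s
        change θ ((k • ζ).smulRight a) = k • θ (ζ.smulRight a)
        rw [← map_smul]
        congr 1
        ext z
        simp }
  let h : N →ₗ[R] Tau K f :=
    { toFun := fun a => (A a : Transpose f →ₗ[K] K)
      map_add' := by
        intro a b
        refine LinearMap.ext fun t => ?_
        obtain ⟨ζ, rfl⟩ := Submodule.Quotient.mk_surjective _ t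
        change θ (ζ.smulRight (a + b)) = θ (ζ.smulRight a) + θ (ζ.smulRight b)
        rw [← map_add]
        congr 1
        ext z
        simp
      map_smul' := by
        intro r a
        refine LinearMap.ext fun t => ?_
        obtain ⟨ζ, rfl⟩ := Submodule.Quotient.mk_surjective _ t
        change θ (ζ.smulRight (r • a)) = θ ((op r • ζ).smulRight a)
        congr 1
        ext z
        simp [mul_smul] }
  have hzero : ∀ a ζ, θ (LinearMap.smulRight (ζ : P₁ →ₗ[R] R) a) = 0 := by
    intro a ζ
    have h1 : A a = 0 := LinearMap.congr_fun (hf h) a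
    exact LinearMap.congr_fun h1 (Submodule.Quotient.mk ζ)
  refine hθ (LinearMap.ext fun k => ?_)
  rw [eq_sum_smulRight_of_dualBasis hx k, map_sum]
  exact Finset.sum_eq_zero fun j _ => hzero _ _

end TauRigid

/-! ### The functor `Hom(E, -)` on maps and on `add E` -/

section HomMap

variable {R : Type u} [Ring R] (E : Type u) [AddCommGroup E] [Module R E]
variable {M N L : Type u} [AddCommGroup M] [Module R M] [AddCommGroup N] [Module R N]
  [AddCommGroup L] [Module R L]

/-- The map of `(End E)ᵒᵖ`-modules `Hom(E, φ) : Hom(E, M) → Hom(E, N)`. -/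
def homMap (φ : M →ₗ[R] N) : (E →ₗ[R] M) →ₗ[(Module.End R E)ᵐᵒᵖ] (E →ₗ[R] N) where
  toFun f := φ ∘ₗ f
  map_add' f g := LinearMap.comp_add f g φ
  map_smul' _ _ := rfl

@[simp]
theorem homMap_apply (φ : M →ₗ[R] N) (f : E →ₗ[R] M) : homMap E φ f = φ ∘ₗ f := rfl

theorem homMap_comp (ψ : N →ₗ[R] L) (φ : M →ₗ[R] N) :
    homMap E (ψ ∘ₗ φ) = homMap E ψ ∘ₗ homMap E φ := rfl

theorem homMap_id : homMap E (LinearMap.id : M →ₗ[R] M) = LinearMap.id := rfl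

theorem homMap_zero : homMap E (0 : M →ₗ[R] N) = 0 :=
  LinearMap.ext fun f => LinearMap.zero_comp f

/-- An isomorphism `M ≃ N` induces an isomorphism `Hom(E, M) ≃ Hom(E, N)`. -/
def homEquiv (e : M ≃ₗ[R] N) : (E →ₗ[R] M) ≃ₗ[(Module.End R E)ᵐᵒᵖ] (E →ₗ[R] N) :=
  LinearEquiv.ofLinearMap (homMap E e.toLinearMap) (homMap E e.symm.toLinearMap)
    (by rw [← homMap_comp, LinearEquiv.comp_symm, homMap_id])
    (by rw [← homMap_comp, LinearEquiv.symm_comp, homMap_id])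

/-- `Hom(E, E)` is the regular module. -/
def homSelfEquiv : (E →ₗ[R] E) ≃ₗ[(Module.End R E)ᵐᵒᵖ] (Module.End R E)ᵐᵒᵖ where
  toFun f := op f
  invFun a := a.unop
  map_add' _ _ := rfl
  map_smul' _ _ := rfl
  left_inv _ := rfl
  right_inv _ := rfl

/-- `Hom(E, E ^ n)` is free of rank `n`. -/
def homPiEquiv (n : ℕ) :
    (E →ₗ[R] (Fin n → E)) ≃ₗ[(Module.End R E)ᵐᵒᵖ] (Fin n → (Module.End R E)ᵐᵒᵖ) where
  toFun f := fun i => op (LinearMap.proj i ∘ₗ f)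
  invFun a := LinearMap.pi fun i => (a i).unop
  map_add' _ _ := rfl
  map_smul' _ _ := rfl
  left_inv _ := rfl
  right_inv _ := rfl

variable {E}

theorem InAdd.finite_hom {X : Type u} [AddCommGroup X] [Module R X] (hX : InAdd R E X) :
    Module.Finite (Module.End R E)ᵐᵒᵖ (E →ₗ[R] X) := by
  obtain ⟨n, i, p, hpi⟩ := hX
  have : Module.Finite (Module.End R E)ᵐᵒᵖ (E →ₗ[R] (Fin n → E)) :=
    Module.Finite.equiv (homPiEquiv E n).symm
  refine Module.Finite.of_surjective (homMap E p) fun f => ⟨i ∘ₗ f, ?_⟩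
  rw [homMap_apply, ← LinearMap.comp_assoc, hpi, LinearMap.id_comp]

theorem InAdd.projective_hom {X : Type u} [AddCommGroup X] [Module R X] (hX : InAdd R E X) :
    Module.Projective (Module.End R E)ᵐᵒᵖ (E →ₗ[R] X) := by
  obtain ⟨n, i, p, hpi⟩ := hX
  have : Module.Projective (Module.End R E)ᵐᵒᵖ (E →ₗ[R] (Fin n → E)) :=
    Module.Projective.of_equiv (homPiEquiv E n).symm
  exact Module.Projective.of_split (homMap E i) (homMap E p) (by
    rw [← homMap_comp, hpi, homMap_id])

theorem inAdd_self : InAdd R E E :=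
  ⟨1, LinearMap.pi fun _ => LinearMap.id, LinearMap.proj 0, rfl⟩

theorem InAdd.finite (hE : Module.Finite R E) {X : Type u} [AddCommGroup X] [Module R X]
    (hX : InAdd R E X) : Module.Finite R X := by
  obtain ⟨n, i, p, hpi⟩ := hX
  exact Module.Finite.of_surjective p fun x => ⟨i x, LinearMap.congr_fun hpi x⟩

/-- Surjectivity of `Hom(E, f)` extends from `E` to all of `add E`. -/
theorem InAdd.exists_lift {X : Type u} [AddCommGroup X] [Module R X] (hX : InAdd R E X)
    {f : M →ₗ[R] N} (hf : Function.Surjective (homMap E f)) (h : X →ₗ[R] N) :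
    ∃ k : X →ₗ[R] M, f ∘ₗ k = h := by
  obtain ⟨n, i, p, hpi⟩ := hX
  choose k hk using fun j : Fin n => hf (h ∘ₗ p ∘ₗ LinearMap.single R (fun _ => E) j)
  refine ⟨LinearMap.lsum R (fun _ => E) ℕ k ∘ₗ i, ?_⟩
  have : f ∘ₗ LinearMap.lsum R (fun _ => E) ℕ k = h ∘ₗ p := by
    refine LinearMap.pi_ext' fun j => ?_
    rw [LinearMap.comp_assoc, LinearMap.comp_assoc]
    refine Eq.trans ?_ (hk j)
    rw [homMap_apply]
    congr 1
    ext y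
    simp only [LinearMap.lsum_apply, LinearMap.comp_apply, LinearMap.sum_apply,
      LinearMap.coe_single, LinearMap.proj_apply]
    rw [Finset.sum_eq_single j (fun b _ hb => by rw [Pi.single_eq_of_ne hb, map_zero])
      (fun h => absurd (Finset.mem_univ j) h), Pi.single_eq_same]
  rw [← LinearMap.comp_assoc, this, LinearMap.comp_assoc, hpi, LinearMap.comp_id]

theorem isRightAddApprox_iff {X : Type u} [AddCommGroup X] [Module R X] (hX : InAdd R E X)
    {f : X →ₗ[R] M} : IsRightAddApprox E f ↔ Function.Surjective (homMap E f) := by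
  refine ⟨fun h g => h.2 (ModuleCat.of R E) inAdd_self g, fun h => ⟨hX, fun X' hX' k => ?_⟩⟩
  exact hX'.exists_lift h k

end HomMap

/-! ### Full faithfulness and reflection properties from the full trace -/

section Generator

variable {R : Type u} [Ring R] {E : Type u} [AddCommGroup E] [Module R E]

/-- The trace ideal of `E` is the whole ring. -/
def HasFullTrace (R : Type u) [Ring R] (E : Type u) [AddCommGroup E] [Module R E] : Prop :=
  ∃ (n : ℕ) (p : Fin n → E →ₗ[R] R) (e : Fin n → E), ∑ j, p j (e j) = 1

/-- Some surjection `E ^ n → R` hits `1`; its components are the `p j`. -/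
theorem IsGenerator.hasFullTrace (hE : IsGenerator R E) : HasFullTrace R E := by
  obtain ⟨n, p, hp⟩ := hE.2 (ModuleCat.of R R) (inferInstanceAs (Module.Finite R R))
  obtain ⟨e, he⟩ := hp (1 : R)
  refine ⟨n, fun j => p ∘ₗ LinearMap.single R (fun _ => E) j, e, ?_⟩
  refine Eq.trans ?_ he
  conv_rhs => rw [← Finset.univ_sum_single e, map_sum]
  rfl

variable {M N L : Type u} [AddCommGroup M] [Module R M] [AddCommGroup N] [Module R N]
  [AddCommGroup L] [Module R L]

theorem HasFullTrace.exists_eq_sum (hE : HasFullTrace R E) (x : M) :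
    ∃ (n : ℕ) (g : Fin n → E →ₗ[R] M) (e : Fin n → E), x = ∑ j, g j (e j) := by
  obtain ⟨n, p, e, h⟩ := hE
  refine ⟨n, fun j => (p j).smulRight x, e, ?_⟩
  simp only [LinearMap.smulRight_apply]
  rw [← Finset.sum_smul, h, one_smul]

theorem HasFullTrace.homMap_injective (hE : HasFullTrace R E) :
    Function.Injective (homMap E : (M →ₗ[R] N) → _) := by
  intro φ ψ h
  ext x
  obtain ⟨n, g, e, rfl⟩ := hE.exists_eq_sum x
  rw [map_sum, map_sum]
  exact Finset.sum_congr rfl fun j _ => LinearMap.congr_fun (LinearMap.congr_fun h (g j)) (e j)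

theorem HasFullTrace.homMap_surjective (hE : HasFullTrace R E) :
    Function.Surjective (homMap E : (M →ₗ[R] N) → _) := by
  intro φ
  obtain ⟨n, p, e, hpe⟩ := hE
  have φ_comp : ∀ (f : E →ₗ[R] M) (a : E →ₗ[R] E), φ (f ∘ₗ a) = φ f ∘ₗ a :=
    fun f a => φ.map_smul (op a) f
  -- The formula is forced: if `φ = homMap E ψ`, then `ψ m = ∑ ψ (p j (e j) • m) = ∑ φ ((p
  -- j).smulRight m) (e j)`.
  let G : M → N := fun m => ∑ j, φ ((p j).smulRight m) (e j)
  have G_apply : ∀ (f : E →ₗ[R] M) (x : E), G (f x) = φ f x := by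
    intro f x
    -- `(p j).smulRight x` is an endomorphism of `E`, so linearity of `φ` over `(End E)ᵒᵖ` moves it
    -- outside `φ`.
    have h1 : ∀ j, φ ((p j).smulRight (f x)) (e j) = φ f (p j (e j) • x) := by
      intro j
      have : (p j).smulRight (f x) = f ∘ₗ (p j).smulRight x := by
        ext y
        simp
      rw [this, φ_comp]
      rfl
    simp only [G, h1]
    rw [← map_sum, ← Finset.sum_smul, hpe, one_smul]
  have G_add : ∀ a b, G (a + b) = G a + G b := by
    intro a b
    simp only [G, ← Finset.sum_add_distrib]
    refine Finset.sum_congr rfl fun j _ => ?_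
    have : (p j).smulRight (a + b) = (p j).smulRight a + (p j).smulRight b := by
      ext y
      simp
    rw [this, map_add, LinearMap.add_apply]
  let G' : M →+ N := AddMonoidHom.mk' G G_add
  refine ⟨{ toFun := G, map_add' := G_add, map_smul' := fun r m => ?_ }, ?_⟩
  -- This writes `r • m` as a sum of values of maps from `E`, where `G` agrees with the `R`-linear
  -- maps `φ f`.
  · have h1 : r • m = ∑ k, (p k).smulRight m (r • e k) := by
      simp only [map_smul, LinearMap.smulRight_apply]
      rw [← Finset.smul_sum, ← Finset.sum_smul, hpe, one_smul]
    have h2 : G (r • m) = ∑ k, G ((p k).smulRight m (r • e k)) := by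
      rw [h1]
      exact map_sum G' _ _
    rw [h2]
    simp only [G_apply]
    simp only [map_smul, ← Finset.smul_sum]
    rfl
  · refine LinearMap.ext fun f => LinearMap.ext fun x => G_apply f x

theorem HasFullTrace.surjective_of_homMap (hE : HasFullTrace R E) {φ : M →ₗ[R] N}
    (h : Function.Surjective (homMap E φ)) : Function.Surjective φ := by
  intro x
  obtain ⟨n, g, e, rfl⟩ := hE.exists_eq_sum x
  choose k hk using fun j => h (g j)
  refine ⟨∑ j, k j (e j), ?_⟩
  rw [map_sum]
  exact Finset.sum_congr rfl fun j _ => LinearMap.congr_fun (hk j) (e j)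

/-- `Hom(E, -)` reflects exactness. -/
theorem HasFullTrace.exact_of_homMap (hE : HasFullTrace R E) {φ : M →ₗ[R] N} {ψ : N →ₗ[R] L}
    (h : Function.Exact (homMap E φ) (homMap E ψ)) : Function.Exact φ ψ := by
  have h0 : ψ ∘ₗ φ = 0 := hE.homMap_injective (by
    rw [homMap_zero, homMap_comp]
    exact h.linearMap_comp_eq_zero)
  intro x
  refine ⟨fun hx => ?_, ?_⟩
  · obtain ⟨n, p, e, hpe⟩ := hE
    -- The maps `(p j).smulRight x` land in `ker ψ`, so they lift along `φ`; evaluating the lifts at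
    -- the `e j` and summing gives a preimage of `x`.
    have h1 : ∀ j, ∃ k, homMap E φ k = (p j).smulRight x := fun j => (h _).1 (by
      ext y
      simp [hx])
    choose k hk using h1
    refine ⟨∑ j, k j (e j), ?_⟩
    rw [map_sum]
    have : ∀ j, φ (k j (e j)) = p j (e j) • x := fun j => LinearMap.congr_fun (hk j) (e j)
    simp only [this]
    rw [← Finset.sum_smul, hpe, one_smul]
  · rintro ⟨y, rfl⟩
    exact LinearMap.congr_fun h0 y

theorem HasFullTrace.bijective_iff (hE : HasFullTrace R E) {φ : M →ₗ[R] N} :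
    Function.Bijective (homMap E φ) ↔ Function.Bijective φ := by
  constructor
  · intro h
    let e := LinearEquiv.ofBijective _ h
    obtain ⟨ψ, hψ⟩ := hE.homMap_surjective e.symm.toLinearMap
    have he : homMap E φ = e.toLinearMap := rfl
    have h1 : ψ ∘ₗ φ = LinearMap.id := hE.homMap_injective (by
      rw [homMap_comp, hψ, he, LinearEquiv.symm_comp, homMap_id])
    exact ⟨Function.LeftInverse.injective (LinearMap.congr_fun h1),
      hE.surjective_of_homMap h.2⟩
  · exact fun h => (homEquiv E (LinearEquiv.ofBijective φ h)).bijective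

theorem HasFullTrace.nonempty_equiv (hE : HasFullTrace R E)
    (e : (E →ₗ[R] M) ≃ₗ[(Module.End R E)ᵐᵒᵖ] (E →ₗ[R] N)) : Nonempty (M ≃ₗ[R] N) := by
  obtain ⟨φ, hφ⟩ := hE.homMap_surjective e.toLinearMap
  exact ⟨LinearEquiv.ofBijective φ (hE.bijective_iff.1 (hφ ▸ e.bijective))⟩

theorem HasFullTrace.isRightMinimal_iff (hE : HasFullTrace R E) {f : M →ₗ[R] N} :
    IsRightMinimal (homMap E f) ↔ IsRightMinimal f := by
  constructor
  · intro h g hg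
    exact hE.bijective_iff.1 (h (homMap E g) (by rw [← homMap_comp, hg]))
  · intro h g hg
    obtain ⟨g, rfl⟩ := hE.homMap_surjective g
    exact hE.bijective_iff.2 (h g (hE.homMap_injective hg))

/-- Full faithfulness matches idempotent endomorphisms, and faithfulness also forces `M = 0` when
`Hom(E, M) = 0`. -/
theorem HasFullTrace.isIndecomposable_iff (hE : HasFullTrace R E) :
    IsIndecomposable (Module.End R E)ᵐᵒᵖ (E →ₗ[R] M) ↔ IsIndecomposable R M := by
  rw [isIndecomposable_iff_idempotent, isIndecomposable_iff_idempotent]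
  refine and_congr ?_ ⟨fun h e he => ?_, fun h e he => ?_⟩
  · rw [← not_subsingleton_iff_nontrivial, ← not_subsingleton_iff_nontrivial, not_iff_not]
    refine ⟨fun h => ⟨fun x y => ?_⟩, fun h => inferInstance⟩
    have : (LinearMap.id : M →ₗ[R] M) = 0 := hE.homMap_injective
      (LinearMap.ext fun f => Subsingleton.elim _ _)
    exact (LinearMap.congr_fun this x).trans (LinearMap.congr_fun this y).symm
  · refine (h (homMap E e) (by rw [← homMap_comp, he])).imp (fun h => ?_) fun h => ?_
    · exact hE.homMap_injective (h.trans (homMap_zero E).symm)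
    · exact hE.homMap_injective h
  · obtain ⟨e, rfl⟩ := hE.homMap_surjective e
    refine (h e (hE.homMap_injective he)).imp (fun h => ?_) fun h => ?_
    · rw [h, homMap_zero]
    · rw [h, homMap_id]

/-- Every finitely generated projective `(End E)ᵒᵖ`-module is of the form `Hom(E, X)` with
`X ∈ add E`. -/
theorem HasFullTrace.exists_inAdd_equiv (hE : HasFullTrace R E) (P : Type u) [AddCommGroup P]
    [Module (Module.End R E)ᵐᵒᵖ P] (hfin : Module.Finite (Module.End R E)ᵐᵒᵖ P)
    (hproj : Module.Projective (Module.End R E)ᵐᵒᵖ P) :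
    ∃ X : ModuleCat.{u} R, InAdd R E X ∧
      Nonempty (P ≃ₗ[(Module.End R E)ᵐᵒᵖ] (E →ₗ[R] X)) := by
  obtain ⟨n, q, hq⟩ := Module.Finite.exists_fin' (Module.End R E)ᵐᵒᵖ P
  obtain ⟨s, hs⟩ := Module.projective_lifting_property q LinearMap.id hq
  obtain ⟨π, σ, hπσ⟩ : ∃ (π : (E →ₗ[R] (Fin n → E)) →ₗ[(Module.End R E)ᵐᵒᵖ] P)
      (σ : P →ₗ[(Module.End R E)ᵐᵒᵖ] (E →ₗ[R] (Fin n → E))), π ∘ₗ σ = LinearMap.id := by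
    refine ⟨q ∘ₗ (homPiEquiv E n).toLinearMap, (homPiEquiv E n).symm.toLinearMap ∘ₗ s,
      LinearMap.ext fun x => ?_⟩
    simp only [LinearMap.comp_apply, LinearEquiv.coe_coe, LinearEquiv.apply_symm_apply]
    exact LinearMap.congr_fun hs x
  -- The idempotent `σ ∘ π` cutting out `P` comes from an idempotent `ε` of `E ^ n`, whose image is
  -- the required `X`.
  obtain ⟨ε, hε⟩ := hE.homMap_surjective (σ ∘ₗ π)
  have hεε : ε ∘ₗ ε = ε := hE.homMap_injective (by
    rw [homMap_comp, hε, LinearMap.comp_assoc, ← LinearMap.comp_assoc π σ π, hπσ,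
      LinearMap.id_comp])
  let X := LinearMap.range ε
  let i : X →ₗ[R] (Fin n → E) := X.subtype
  let p : (Fin n → E) →ₗ[R] X := ε.rangeRestrict
  have hip : i ∘ₗ p = ε := rfl
  have hpi : p ∘ₗ i = LinearMap.id := by
    refine LinearMap.ext ?_
    rintro ⟨_, y, rfl⟩
    exact Subtype.ext (LinearMap.congr_fun hεε y)
  refine ⟨ModuleCat.of R X, ⟨n, i, p, hpi⟩,
    ⟨LinearEquiv.ofLinearMap (homMap E p ∘ₗ σ) (π ∘ₗ homMap E i) ?_ ?_⟩⟩
  · rw [LinearMap.comp_assoc, ← LinearMap.comp_assoc (homMap E i) π σ, ← hε, ← homMap_comp,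
      ← homMap_comp, ← hip, LinearMap.comp_assoc, hpi, LinearMap.comp_id, hpi, homMap_id]
  · rw [LinearMap.comp_assoc, ← LinearMap.comp_assoc σ (homMap E p) (homMap E i), ← homMap_comp,
      hip, hε, LinearMap.comp_assoc, hπσ, LinearMap.comp_id, hπσ]

end Generator

/-! ### Invariance under isomorphism -/

section Transport

variable {R : Type u} [Ring R] {M N : Type v} [AddCommGroup M] [Module R M]
  [AddCommGroup N] [Module R N]

theorem IsIndecomposable.of_equiv (e : M ≃ₗ[R] N) (h : IsIndecomposable R M) :
    IsIndecomposable R N := by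
  rw [isIndecomposable_iff_idempotent] at h ⊢
  have := h.1
  refine ⟨e.symm.toEquiv.nontrivial, fun a ha => ?_⟩
  have ha' : ∀ y, a (a y) = a y := LinearMap.congr_fun ha
  refine (h.2 (e.symm.toLinearMap ∘ₗ a ∘ₗ e.toLinearMap) ?_).imp (fun h => ?_) fun h => ?_
  · ext x
    simp [ha']
  all_goals
    ext y
    have := LinearMap.congr_fun h (e.symm y)
    simpa using this

theorem IsTauRigid.of_equiv (K : Type w) [Field K] [Algebra K R] (e : M ≃ₗ[R] N)
    (h : IsTauRigid K R M) : IsTauRigid K R N := by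
  obtain ⟨P₁, P₀, f₁, f₀, hf, h0⟩ := h
  have hker : LinearMap.ker (e.toLinearMap ∘ₗ f₀) = LinearMap.ker f₀ := LinearEquiv.ker_comp _ _
  refine ⟨P₁, P₀, f₁, e.toLinearMap ∘ₗ f₀, ⟨?_, ⟨hf.cover₀.finite, hf.cover₀.projective,
    e.surjective.comp hf.cover₀.surjective, fun L hL => hf.cover₀.superfluous L (hker ▸ hL)⟩,
    hf.cover₁⟩, fun k => ?_⟩
  · rw [LinearMap.exact_iff, hker]
    exact LinearMap.exact_iff.1 hf.exact
  · refine LinearMap.ext fun y => ?_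
    have := LinearMap.congr_fun (h0 (k ∘ₗ e.toLinearMap)) (e.symm y)
    simpa using this

/-- Removes the codomain from minimality, so that `Hom(E, Im f₁)` and `Im Hom(E, f₁)` need not be
compared. -/
theorem isRightMinimal_rangeRestrict_iff {f : M →ₗ[R] N} :
    IsRightMinimal f.rangeRestrict ↔ IsRightMinimal f := by
  refine forall_congr' fun g => imp_congr_left ⟨fun h => ?_, fun h => ?_⟩
  · exact LinearMap.ext fun x => congrArg Subtype.val (LinearMap.congr_fun h x)
  · exact LinearMap.ext fun x => Subtype.ext (LinearMap.congr_fun h x)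

theorem IsRightMinimal.of_equiv {M' N' : Type*} [AddCommGroup M'] [Module R M']
    [AddCommGroup N'] [Module R N'] {f : M →ₗ[R] N} (hf : IsRightMinimal f) {f' : M' →ₗ[R] N'}
    (e : M ≃ₗ[R] M') (e' : N ≃ₗ[R] N') (h : ∀ x, f' (e x) = e' (f x)) : IsRightMinimal f' := by
  intro g hg
  have hg' : ∀ y, f' (g y) = f' y := LinearMap.congr_fun hg
  have hb := hf (e.symm.toLinearMap ∘ₗ g ∘ₗ e.toLinearMap) (by
    ext x
    apply e'.injective
    simp [← h, hg'])
  have : (g : M' → M') = e ∘ (e.symm.toLinearMap ∘ₗ g ∘ₗ e.toLinearMap) ∘ e.symm := by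
    funext y
    simp
  rw [this]
  exact e.bijective.comp (hb.comp e.symm.bijective)

end Transport

/-! ### Exactness, images and duals under `Hom(E, -)` -/

section HomExact

variable {R : Type u} [Ring R] {E : Type u} [AddCommGroup E] [Module R E]
variable {M N L : Type u} [AddCommGroup M] [Module R M] [AddCommGroup N] [Module R N]
  [AddCommGroup L] [Module R L] {φ : M →ₗ[R] N} {ψ : N →ₗ[R] L}

theorem homMap_rangeRestrict_surjective (h : Function.Exact φ ψ)
    (hE : Function.Exact (homMap E φ) (homMap E ψ)) :
    Function.Surjective (homMap E φ.rangeRestrict) := by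
  intro g
  obtain ⟨k, hk⟩ := (hE ((LinearMap.range φ).subtype ∘ₗ g)).1
    (LinearMap.ext fun x => (h _).2 (g x).2)
  exact ⟨k, LinearMap.ext fun x => Subtype.ext (LinearMap.congr_fun hk x)⟩

theorem exact_homMap (h : Function.Exact φ ψ)
    (hE : Function.Surjective (homMap E φ.rangeRestrict)) :
    Function.Exact (homMap E φ) (homMap E ψ) := by
  intro g
  refine ⟨fun hg => ?_, ?_⟩
  · obtain ⟨k, hk⟩ := hE (g.codRestrict (LinearMap.range φ)
      fun x => (h _).1 (LinearMap.congr_fun hg x))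
    exact ⟨k, LinearMap.ext fun x => congrArg Subtype.val (LinearMap.congr_fun hk x)⟩
  · rintro ⟨k, rfl⟩
    exact LinearMap.ext fun x => h.apply_apply_eq_zero (k x)

/-- `Hom(E, Im φ)` is the image of `Hom(E, φ)` if `Hom(E, M) → Hom(E, Im φ)` is surjective. -/
theorem nonempty_hom_range_equiv (hE : Function.Surjective (homMap E φ.rangeRestrict)) :
    Nonempty ((E →ₗ[R] LinearMap.range φ) ≃ₗ[(Module.End R E)ᵐᵒᵖ]
      LinearMap.range (homMap E φ)) := by
  have hinj : Function.Injective (homMap E (LinearMap.range φ).subtype) := fun f g h =>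
    LinearMap.ext fun x => Subtype.ext (LinearMap.congr_fun h x)
  have hr : LinearMap.range (homMap E (LinearMap.range φ).subtype) =
      LinearMap.range (homMap E φ) :=
    (LinearMap.range_comp_of_range_eq_top _ (LinearMap.range_eq_top.2 hE)).symm
  exact ⟨(LinearEquiv.ofInjective _ hinj).trans (LinearEquiv.ofEq _ _ hr)⟩

variable {P Q S : Type u} [AddCommGroup P] [Module (Module.End R E)ᵐᵒᵖ P]
  [AddCommGroup Q] [Module (Module.End R E)ᵐᵒᵖ Q] [AddCommGroup S] [Module (Module.End R E)ᵐᵒᵖ S]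

/-- Under `Hom(E, -)`, exactness of the `E`-dual corresponds to exactness of the ring dual. -/
theorem HasFullTrace.exact_dual_iff (hE : HasFullTrace R E)
    (eM : P ≃ₗ[(Module.End R E)ᵐᵒᵖ] (E →ₗ[R] M)) (eN : Q ≃ₗ[(Module.End R E)ᵐᵒᵖ] (E →ₗ[R] N))
    (eL : S ≃ₗ[(Module.End R E)ᵐᵒᵖ] (E →ₗ[R] L))
    {a : P →ₗ[(Module.End R E)ᵐᵒᵖ] Q} {b : Q →ₗ[(Module.End R E)ᵐᵒᵖ] S}
    (ha : ∀ x, homMap E φ (eM x) = eN (a x)) (hb : ∀ x, homMap E ψ (eN x) = eL (b x)) :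
    Function.Exact (fun g : S →ₗ[(Module.End R E)ᵐᵒᵖ] (Module.End R E)ᵐᵒᵖ => g ∘ₗ b)
        (fun g : Q →ₗ[(Module.End R E)ᵐᵒᵖ] (Module.End R E)ᵐᵒᵖ => g ∘ₗ a) ↔
      Function.Exact (fun g : L →ₗ[R] E => g ∘ₗ ψ) (fun g : N →ₗ[R] E => g ∘ₗ φ) := by
  -- Since `Hom(E, E)` is the regular module, functionals on `Y ≃ Hom(E, X)` are exactly the maps
  -- induced by `X → E`.
  have T_surj : ∀ {X : Type u} [AddCommGroup X] [Module R X] {Y : Type u} [AddCommGroup Y]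
      [Module (Module.End R E)ᵐᵒᵖ Y] (e : Y ≃ₗ[(Module.End R E)ᵐᵒᵖ] (E →ₗ[R] X))
      (g : Y →ₗ[(Module.End R E)ᵐᵒᵖ] (Module.End R E)ᵐᵒᵖ),
      ∃ γ : X →ₗ[R] E, ∀ y, g y = homSelfEquiv E (homMap E γ (e y)) := by
    intro X _ _ Y _ _ e g
    obtain ⟨γ, hγ⟩ := hE.homMap_surjective ((homSelfEquiv E).symm.toLinearMap ∘ₗ g ∘ₗ
      e.symm.toLinearMap)
    exact ⟨γ, fun y => by simp [hγ, -homMap_apply]⟩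
  have T_inj : ∀ {X : Type u} [AddCommGroup X] [Module R X] {Y : Type u} [AddCommGroup Y]
      [Module (Module.End R E)ᵐᵒᵖ Y] (e : Y ≃ₗ[(Module.End R E)ᵐᵒᵖ] (E →ₗ[R] X))
      (γ γ' : X →ₗ[R] E), (∀ y, homMap E γ (e y) = homMap E γ' (e y)) → γ = γ' := by
    intro X _ _ Y _ _ e γ γ' h
    refine hE.homMap_injective (LinearMap.ext fun f => ?_)
    simpa [-homMap_apply] using h (e.symm f)
  constructor
  · intro h γ
    constructor
    · intro hγ
      replace hγ : γ ∘ₗ φ = 0 := hγ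
      obtain ⟨g, hg⟩ := (h ((homSelfEquiv E).toLinearMap ∘ₗ homMap E γ ∘ₗ eN.toLinearMap)).1 (by
        ext1 x
        simp only [LinearMap.comp_apply, LinearEquiv.coe_coe, ← ha]
        rw [← LinearMap.comp_apply, ← homMap_comp, hγ, homMap_zero]
        simp)
      obtain ⟨γ', hγ'⟩ := T_surj eL g
      refine ⟨γ', T_inj eN _ _ fun y => (homSelfEquiv E).injective ?_⟩
      have := LinearMap.congr_fun hg y
      simp only [LinearMap.comp_apply, LinearEquiv.coe_coe, hγ', ← hb] at this
      exact this
    · rintro ⟨γ', rfl⟩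
      have h2 := (h ((homSelfEquiv E).toLinearMap ∘ₗ homMap E γ' ∘ₗ eL.toLinearMap ∘ₗ b)).2
        ⟨(homSelfEquiv E).toLinearMap ∘ₗ homMap E γ' ∘ₗ eL.toLinearMap, rfl⟩
      refine T_inj eM _ _ fun y => (homSelfEquiv E).injective ?_
      have := LinearMap.congr_fun h2 y
      simp only [LinearMap.comp_apply, LinearEquiv.coe_coe, ← hb, ← ha] at this
      rw [homMap_zero]
      exact this
  · intro h g
    obtain ⟨γ, hγ⟩ := T_surj eN g
    constructor
    · intro hg
      obtain ⟨γ', hγ'⟩ := (h γ).1 (T_inj eM _ _ fun y => (homSelfEquiv E).injective (by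
        have := LinearMap.congr_fun hg y
        simp only [LinearMap.comp_apply, hγ, ← ha] at this
        rw [homMap_zero]
        exact this))
      replace hγ' : γ' ∘ₗ ψ = γ := hγ'
      refine ⟨(homSelfEquiv E).toLinearMap ∘ₗ homMap E γ' ∘ₗ eL.toLinearMap,
        LinearMap.ext fun y => ?_⟩
      simp only [LinearMap.comp_apply, LinearEquiv.coe_coe, ← hb, hγ, ← hγ']
      rfl
    · rintro ⟨k, hk⟩
      obtain ⟨γ', hγ'⟩ := T_surj eL k
      have h1 : γ' ∘ₗ ψ = γ := T_inj eN _ _ fun y => (homSelfEquiv E).injective (by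
        rw [← hγ, ← hk]
        simp only [LinearMap.comp_apply, hγ', ← hb]
        rfl)
      have h2 : γ ∘ₗ φ = 0 := (h γ).2 ⟨γ', h1⟩
      refine LinearMap.ext fun y => ?_
      simp only [LinearMap.comp_apply, hγ, ← ha]
      rw [← LinearMap.comp_apply, ← homMap_comp, h2, homMap_zero]
      simp

theorem HasFullTrace.surjective_comp_iff (hE : HasFullTrace R E) :
    Function.Surjective (fun g : (E →ₗ[R] N) →ₗ[(Module.End R E)ᵐᵒᵖ] (E →ₗ[R] L) =>
      g ∘ₗ homMap E φ) ↔ Function.Surjective (fun g : N →ₗ[R] L => g ∘ₗ φ) := by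
  constructor
  · intro h k
    obtain ⟨g, hg⟩ := h (homMap E k)
    obtain ⟨g, rfl⟩ := hE.homMap_surjective g
    exact ⟨g, hE.homMap_injective hg⟩
  · intro h k
    obtain ⟨k, rfl⟩ := hE.homMap_surjective k
    obtain ⟨g, rfl⟩ := h k
    exact ⟨homMap E g, rfl⟩

end HomExact

/-! ### Correspondence of Gorenstein projectives -/

section Gorenstein

variable {R : Type u} [Ring R] {E : Type u} [AddCommGroup E] [Module R E]

theorem IsGorensteinProjective.finite {M : Type v} [AddCommGroup M] [Module R M]
    (h : IsGorensteinProjective R M) : Module.Finite R M := by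
  obtain ⟨P, d, hP, -, -, ⟨e⟩⟩ := h
  have := (hP (-1)).1
  exact Module.Finite.equiv e.symm

theorem IsEGorensteinProjective.finite (hE : Module.Finite R E) {M : Type u} [AddCommGroup M]
    [Module R M] (h : IsEGorensteinProjective R E M) : Module.Finite R M := by
  obtain ⟨X, d, hX, -, -, -, ⟨e⟩⟩ := h
  have := (hX 0).finite hE
  exact Module.Finite.equiv e.symm

theorem IsEGorensteinProjective.hom (hE : HasFullTrace R E) {M : Type u} [AddCommGroup M]
    [Module R M] (h : IsEGorensteinProjective R E M) :
    IsGorensteinProjective (Module.End R E)ᵐᵒᵖ (E →ₗ[R] M) := by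
  obtain ⟨X, d, hX, hd, hd', hd'', ⟨e⟩⟩ := h
  obtain ⟨e'⟩ := nonempty_hom_range_equiv (homMap_rangeRestrict_surjective (hd 0) (hd'' 0))
  -- The shift by one puts `d 0` at index `-1`.
  exact ⟨fun i => ModuleCat.of _ (E →ₗ[R] X (i + 1)), fun i => homMap E (d (i + 1)),
    fun i => ⟨(hX _).finite_hom, (hX _).projective_hom⟩, fun i => hd'' (i + 1),
    fun i => (hE.exact_dual_iff (LinearEquiv.refl _ _) (LinearEquiv.refl _ _)
      (LinearEquiv.refl _ _) (fun _ => rfl) (fun _ => rfl)).2 (hd' (i + 1)),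
    ⟨(homEquiv E e).trans e'⟩⟩

/-- The whole complete resolution is lifted: its terms to `add E`, its differentials by fullness.
Exactness is reflected, and `M` is the image of the lifted `δ 0`. -/
theorem IsGorensteinProjective.exists_hom_equiv (hE : HasFullTrace R E) {N : Type u}
    [AddCommGroup N] [Module (Module.End R E)ᵐᵒᵖ N]
    (h : IsGorensteinProjective (Module.End R E)ᵐᵒᵖ N) :
    ∃ M : ModuleCat.{u} R, IsEGorensteinProjective R E M ∧
      Nonempty (N ≃ₗ[(Module.End R E)ᵐᵒᵖ] (E →ₗ[R] M)) := by
  obtain ⟨P, d, hP, hd, hd', ⟨e⟩⟩ := h.exists_range_zero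
  choose X hX ε using fun i => hE.exists_inAdd_equiv (P i) (hP i).1 (hP i).2
  let ε := fun i => (ε i).some
  choose δ hδ using fun i => hE.homMap_surjective
    ((ε (i + 1)).toLinearMap ∘ₗ d i ∘ₗ (ε i).symm.toLinearMap)
  have hcomm : ∀ i x, homMap E (δ i) (ε i x) = ε (i + 1) (d i x) := by
    intro i x
    rw [hδ]
    simp
  have hex : ∀ i, Function.Exact (homMap E (δ i)) (homMap E (δ (i + 1))) := fun i =>
    (Function.Exact.iff_of_ladder_linearEquiv (e₁ := ε i) (e₂ := ε (i + 1)) (e₃ := ε (i + 1 + 1))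
      (LinearMap.ext (hcomm i)) (LinearMap.ext (hcomm (i + 1)))).2 (hd i)
  have hex' : ∀ i, Function.Exact (δ i) (δ (i + 1)) := fun i => hE.exact_of_homMap (hex i)
  refine ⟨ModuleCat.of R (LinearMap.range (δ 0)), ⟨X, δ, hX, hex', fun i =>
    (hE.exact_dual_iff (ε i) (ε (i + 1)) (ε (i + 1 + 1)) (hcomm i) (hcomm (i + 1))).1 (hd' i),
    hex, ⟨LinearEquiv.refl _ _⟩⟩, ?_⟩
  obtain ⟨e'⟩ := nonempty_hom_range_equiv (homMap_rangeRestrict_surjective (hex' 0) (hex 0))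
  have hr : (LinearMap.range (d 0)).map (ε (0 + 1)).toLinearMap =
      LinearMap.range (homMap E (δ 0)) := by
    rw [hδ, ← LinearMap.range_comp, ← LinearMap.comp_assoc,
      LinearMap.range_comp_of_range_eq_top _ (ε 0).symm.range]
  exact ⟨(e.trans ((ε (0 + 1)).submoduleMap _)).trans ((LinearEquiv.ofEq _ _ hr).trans e'.symm)⟩

end Gorenstein

/-! ### Correspondence of `E`-rigid and `τ`-rigid modules -/

section Rigid

variable {R : Type u} [Ring R] {E : Type u} [AddCommGroup E] [Module R E]
  {M : Type u} [AddCommGroup M] [Module R M]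

theorem IsERigid.isTauRigid_hom (K : Type u) [Field K] [Algebra K (Module.End R E)ᵐᵒᵖ]
    (hE : HasFullTrace R E) (h : IsERigid R E M) :
    IsTauRigid K (Module.End R E)ᵐᵒᵖ (E →ₗ[R] M) := by
  obtain ⟨E₁, E₀, f₁, f₀, hf, hs⟩ := h
  have h₁ := hf.approx₁.1
  have h₀ := hf.approx₀.1
  refine ⟨ModuleCat.of _ (E →ₗ[R] E₁), ModuleCat.of _ (E →ₗ[R] E₀), homMap E f₁, homMap E f₀,
    ⟨exact_homMap hf.exact ((isRightAddApprox_iff h₁).1 hf.approx₁),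
      isProjectiveCover_of_isRightMinimal h₀.finite_hom h₀.projective_hom
        ((isRightAddApprox_iff h₀).1 hf.approx₀) (hE.isRightMinimal_iff.2 hf.minimal₀),
      isProjectiveCover_of_isRightMinimal h₁.finite_hom h₁.projective_hom
        (LinearMap.surjective_rangeRestrict _) ?_⟩, ?_⟩
  · exact isRightMinimal_rangeRestrict_iff.2
      (hE.isRightMinimal_iff.2 (isRightMinimal_rangeRestrict_iff.1 hf.minimal₁))
  · exact eq_zero_of_surjective_comp K h₁.finite_hom h₁.projective_hom h₀.finite_hom
      h₀.projective_hom (hE.surjective_comp_iff.2 hs)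

theorem HasFullTrace.isERigid_of_isTauRigid_hom (K : Type u) [Field K]
    [Algebra K (Module.End R E)ᵐᵒᵖ] (hE : HasFullTrace R E)
    (h : IsTauRigid K (Module.End R E)ᵐᵒᵖ (E →ₗ[R] M)) : IsERigid R E M := by
  obtain ⟨P₁, P₀, f₁, f₀, hf, h0⟩ := h
  have hs := surjective_comp_of_forall_eq_zero K hf.cover₁.finite hf.cover₁.projective h0
  obtain ⟨X₁, hX₁, ⟨e₁⟩⟩ := hE.exists_inAdd_equiv P₁ hf.cover₁.finite hf.cover₁.projective
  obtain ⟨X₀, hX₀, ⟨e₀⟩⟩ := hE.exists_inAdd_equiv P₀ hf.cover₀.finite hf.cover₀.projective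
  obtain ⟨φ₁, hφ₁⟩ := hE.homMap_surjective (e₀.toLinearMap ∘ₗ f₁ ∘ₗ e₁.symm.toLinearMap)
  obtain ⟨φ₀, hφ₀⟩ := hE.homMap_surjective (f₀ ∘ₗ e₀.symm.toLinearMap)
  have hc₁ : ∀ x, homMap E φ₁ (e₁ x) = e₀ (f₁ x) := fun x => by
    rw [hφ₁]
    simp
  have hc₀ : ∀ x, homMap E φ₀ (e₀ x) = f₀ x := fun x => by
    rw [hφ₀]
    simp
  have hex : Function.Exact (homMap E φ₁) (homMap E φ₀) :=
    (Function.Exact.iff_of_ladder_linearEquiv (e₁ := e₁) (e₂ := e₀) (e₃ := LinearEquiv.refl _ _)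
      (LinearMap.ext hc₁) (LinearMap.ext hc₀)).2 hf.exact
  have hsurj : Function.Surjective (homMap E φ₀) := fun y => by
    obtain ⟨x, rfl⟩ := hf.cover₀.surjective y
    exact ⟨e₀ x, hc₀ x⟩
  have hex' := hE.exact_of_homMap hex
  refine ⟨X₁, X₀, φ₁, φ₀, ⟨hex', hE.surjective_of_homMap hsurj,
    (isRightAddApprox_iff hX₀).2 hsurj, ?_,
    (isRightAddApprox_iff hX₁).2 (homMap_rangeRestrict_surjective hex' hex), ?_⟩, ?_⟩
  · exact hE.isRightMinimal_iff.1
      (hf.cover₀.isRightMinimal.of_equiv e₀ (LinearEquiv.refl _ _) hc₀)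
  · exact isRightMinimal_rangeRestrict_iff.2 (hE.isRightMinimal_iff.1
      ((isRightMinimal_rangeRestrict_iff.1 hf.cover₁.isRightMinimal).of_equiv e₁ e₀ hc₁))
  -- Surjectivity of `Hom(f₁, -)` is carried along `e₁` and `e₀` to `homMap E φ₁`.
  · refine hE.surjective_comp_iff.1 fun k => ?_
    obtain ⟨g, hg⟩ := hs (k ∘ₗ e₁.toLinearMap)
    refine ⟨g ∘ₗ e₀.symm.toLinearMap, LinearMap.ext fun x => ?_⟩
    have := LinearMap.congr_fun hg (e₁.symm x)
    rw [hφ₁]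
    simpa using this

end Rigid

end ERigid

end

theorem theorem4p7 {K Λ E : Type u} [Field K] [IsAlgClosed K]
    [Ring Λ] [Algebra K Λ] [FiniteDimensional K Λ]
    [AddCommGroup E] [Module Λ E] [Module K E] [IsScalarTower K Λ E]
    (hE : ERigid.IsGenerator Λ E) :
    Set.BijOn (ERigid.homIsoClass Λ E) (ERigid.EG Λ E)
      (ERigid.TG K (Module.End Λ E)ᵐᵒᵖ) := by
  have hT := hE.hasFullTrace
  refine ⟨?_, ?_, ?_⟩
  · rintro _ ⟨M, rfl, -, hind, hG, hR⟩
    exact ⟨ModuleCat.of _ (E →ₗ[Λ] M), rfl, (hG.hom hT).finite, hT.isIndecomposable_iff.2 hind,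
      hG.hom hT, hR.isTauRigid_hom K hT⟩
  · rintro _ ⟨M, rfl, -⟩ _ ⟨N, rfl, -⟩ h
    obtain ⟨i⟩ := Quotient.exact h
    obtain ⟨e⟩ := hT.nonempty_equiv i.toLinearEquiv
    exact Quotient.sound ⟨e.toModuleIso⟩
  · rintro _ ⟨N, rfl, -, hind, hG, hR⟩
    obtain ⟨M, hM, ⟨e⟩⟩ := hG.exists_hom_equiv hT
    refine ⟨Quotient.mk _ M, ⟨M, rfl, hM.finite hE.1,
      hT.isIndecomposable_iff.1 (hind.of_equiv e), hM,
      hT.isERigid_of_isTauRigid_hom K (hR.of_equiv K e)⟩, ?_⟩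
    exact Quotient.sound ⟨e.symm.toModuleIso⟩
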